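/- Consider an undiscounted finite-horizon Markov decision process with state space $\mathbb{R}^{d_s}$, action space $\mathbb{R}^{d_a}$, horizon $T$, initial state distribution $\rho_1$, a time-independent transition kernel, and measurable reward functions $r_1,\dots,r_T$ on state-action pairs. A policy $\pi$ is a family of conditional action laws $\pi_t(\cdot\mid s)$, $t=1,\dots,T$. Its return is $J(\pi)=\mathbb{E}\big[\sum_{t=1}^T r_t(s_t,a_t)\big]$, where $s_1\sim\rho_1$, $a_t\sim\pi_t(\cdot\mid s_t)$ and $s_{t+1}$ is drawn from the transition kernel at $(s_t,a_t)$. Put $Q^\pi_t(s,a)=\mathbb{E}\big[\sum_{t'=t}^T r_{t'}(s_{t'},a_{t'})\mid s_t=s,\,a_t=a\big]$ with actions after time $t$ drawn from $\pi$, $V^\pi_t(s)=\mathbb{E}_{a\sim\pi_t(\cdot\mid s)}[Q^\pi_t(s,a)]$ and $A^\pi_t=Q^\pi_t-V^\pi_t$. Let $p,q$ be two policies, write $p_t,q_t$ also for the distributions of $s_t$ under $p$ and $q$, and let $\varepsilon>0$. Assume that all the expectations below exist: the rewards along trajectories of $p$ and of $q$ are integrable, the rewards along trajectories of $q$ started from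 any $(s,a)$ at any time $t$ are integrable, and $Q^q_t(s,\cdot)$ is integrable with respect to $q_t(\cdot\mid s)$ and to $p_t(\cdot\mid s)$ for all $t$ and $s$. Assume that $$\delta_t=\sup_s\big|\mathbb{E}_{a\sim p_t(\cdot\mid s)}[A^q_t(s,a)]\big|$$ is finite for every $t$. Assume further that for every $t=1,\dots,T$: (i) the state distributions $p_t$ and $q_t$ are Gaussian (possibly degenerate); (ii) the policies are linear-Gaussian, i.e. $p_t(\cdot\mid s)=\mathcal N(K_ts+k_t,\Sigma_t)$ and $q_t(\cdot\mid s)=\mathcal N(K'_ts+k'_t,\Sigma'_t)$ with $\Sigma_t,\Sigma'_t$ positive definite; (iii) $\mathbb{E}_{s\sim q_t}\big[\mathrm{KL}\big(p_t(\cdot\mid s)\,\|\,q_t(\cdot\mid s)\big)\big]\le\varepsilon$. Then $$J(p)-J(q)\;\ge\;\sum_{t=1}^{T}\mathbb{E}_{s\sim q_t,\,a\sim p_t(\cdot\mid s)}\big[A^q_t(s,a)\big]-\sum_{t=1}^{T}\delta_t\,f_t(\varepsilon),$$ where $f_1,f_2,\dots$ are functions with $f_t(\varepsilon)=O(\sqrt{\varepsilon})$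 as $\varepsilon\to0^+$ that depend only on $d_s$ and $t$ (not on $d_a$, $T$, the decision process or the policies). The expectation on the right is taken as the iterated integral, first over $a$ and then over $s$. -/

import Mathlib

open MeasureTheory ProbabilityTheory InformationTheory
open scoped ENNReal Topology

noncomputable section

/-- An undiscounted Markov decision process with state space `S` and action space `A`: a law of the
initial state, a time-independent transition kernel, and one reward function per time-step.
Time-steps are numbered from `0`, so a horizon `T` consists of the time-steps `0, …, T - 1`;
what is recorded for later times plays no role. -/
structure MDP (S A : Type*) [MeasurableSpace S] [MeasurableSpace A] where
  init : Measure S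
  init_prob : IsProbabilityMeasure init
  trans : Kernel (S × A) S
  trans_markov : IsMarkovKernel trans
  reward : ℕ → S × A → ℝ
  reward_meas : ∀ t, Measurable (reward t)

/-- A time-dependent stochastic policy: `act t s` is the law of the action taken in the state `s` at
time-step `t`. Only the time-steps before the horizon matter. -/
structure Policy (S A : Type*) [MeasurableSpace S] [MeasurableSpace A] where
  act : ℕ → Kernel S A
  act_markov : ∀ t, IsMarkovKernel (act t)

attribute [instance] MDP.init_prob MDP.trans_markov Policy.act_markov

namespace MDP

variable {S A : Type*} [MeasurableSpace S] [MeasurableSpace A]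

/-- The kernel that sends `(sₜ, aₜ)` to the law of `(sₜ₊₁, aₜ₊₁)`, where `sₜ₊₁` is drawn from the
transition kernel at `(sₜ, aₜ)` and `aₜ₊₁` from the policy at time-step `t + 1` in `sₜ₊₁`. -/
def step (M : MDP S A) (π : Policy S A) (t : ℕ) : Kernel (S × A) (S × A) :=
  M.trans ⊗ₖ Kernel.prodMkLeft (S × A) (π.act (t + 1))

instance (M : MDP S A) (π : Policy S A) (t : ℕ) : IsMarkovKernel (M.step π t) := by
  unfold step; infer_instance

/-- The law of the path `(sₜ, aₜ), (sₜ₊₁, aₜ₊₁), …` when `(sₜ, aₜ)` has law `μ` and the policy `π` is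
followed afterwards. The `i`-th coordinate of the path is `(sₜ₊ᵢ, aₜ₊ᵢ)`. -/
def pathLaw (M : MDP S A) (π : Policy S A) (t : ℕ) (μ : Measure (S × A)) :
    Measure (ℕ → S × A) :=
  Kernel.trajMeasure (X := fun _ => S × A) μ fun n =>
    (M.step π (t + n)).comap (fun h => h ⟨n, Finset.mem_Iic.2 le_rfl⟩) (measurable_pi_apply _)

/-- The law of the whole path `(s₀, a₀), (s₁, a₁), …` under the policy `π`. -/
def trajLaw (M : MDP S A) (π : Policy S A) : Measure (ℕ → S × A) :=
  M.pathLaw π 0 (M.init ⊗ₘ π.act 0)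

/-- The law of the state at time-step `t` under the policy `π`. -/
def stateDist (M : MDP S A) (π : Policy S A) (t : ℕ) : Measure S :=
  (M.trajLaw π).map fun ω => (ω t).1

/-- The return of the policy `π` for the horizon `T`. -/
def J (M : MDP S A) (T : ℕ) (π : Policy S A) : ℝ :=
  ∫ ω, ∑ t ∈ Finset.range T, M.reward t (ω t) ∂(M.trajLaw π)

/-- The Q-function of `π` at time-step `t` for the horizon `T`: the expected sum of the rewards of
the time-steps `t, …, T - 1`, starting from `(sₜ, aₜ) = x` and following `π` afterwards. -/
def Q (M : MDP S A) (T : ℕ) (π : Policy S A) (t : ℕ) (x : S × A) : ℝ :=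
  ∫ ω, ∑ i ∈ Finset.range (T - t), M.reward (t + i) (ω i) ∂(M.pathLaw π t (Measure.dirac x))

/-- The V-function of `π` at time-step `t`. -/
def V (M : MDP S A) (T : ℕ) (π : Policy S A) (t : ℕ) (s : S) : ℝ :=
  ∫ a, M.Q T π t (s, a) ∂(π.act t s)

/-- The advantage function of `π` at time-step `t`. -/
def adv (M : MDP S A) (T : ℕ) (π : Policy S A) (t : ℕ) (s : S) (a : A) : ℝ :=
  M.Q T π t (s, a) - M.V T π t s

/-- The expected advantage `E_{a ∼ pₜ(·|s)}[Aₜ^q(s, a)]` in the state `s`. -/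
def meanAdv (M : MDP S A) (T : ℕ) (p q : Policy S A) (t : ℕ) (s : S) : ℝ :=
  ∫ a, M.adv T q t s a ∂(p.act t s)

/-- The largest absolute value of the expected advantage over all states (used where the absolute
values are bounded). -/
def maxMeanAdv (M : MDP S A) (T : ℕ) (p q : Policy S A) (t : ℕ) : ℝ :=
  ⨆ s, |M.meanAdv T p q t s|

/-- The rewards collected along the whole path under `π` have expectations, so that the return of
`π` is well defined. -/
def HasReturn (M : MDP S A) (T : ℕ) (π : Policy S A) : Prop :=
  ∀ t < T, Integrable (fun ω => M.reward t (ω t)) (M.trajLaw π)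

/-- The rewards collected after any `(sₜ, aₜ) = x` under `π` have expectations, so that the
Q-function of `π` is well defined at every point. -/
def HasQ (M : MDP S A) (T : ℕ) (π : Policy S A) : Prop :=
  ∀ t < T, ∀ i < T - t, ∀ x,
    Integrable (fun ω => M.reward (t + i) (ω i)) (M.pathLaw π t (Measure.dirac x))

/-- In every state the Q-function of `q` has an expectation under the action law of `p`. For `p = q`
this says that the V-function of `q` is well defined, and given this, for general `p`, that the
expected advantage of `q` under `p` is. -/
def HasMeanQ (M : MDP S A) (T : ℕ) (p q : Policy S A) : Prop :=
  ∀ t < T, ∀ s, Integrable (fun a => M.Q T q t (s, a)) (p.act t s)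

end MDP

/-- A linear-Gaussian policy at one time-step: `κ s` is the normal law with mean `K s + k` and
covariance matrix `C`, for a gain matrix `K`, a bias `k` and a positive definite matrix `C`. -/
def IsLinearGaussian {ds da : ℕ}
    (κ : Kernel (EuclideanSpace ℝ (Fin ds)) (EuclideanSpace ℝ (Fin da))) : Prop :=
  ∃ (K : Matrix (Fin da) (Fin ds) ℝ) (k : EuclideanSpace ℝ (Fin da))
    (C : Matrix (Fin da) (Fin da) ℝ), C.PosDef ∧
    ∀ s, κ s = multivariateGaussian (WithLp.toLp 2 (K.mulVec s.ofLp) + k) C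

end

/-! By the performance difference lemma, `J p - J q` is the sum over `t` of the mean advantage of
`q` under the actions of `p`, averaged over the states of `p` (`J_sub_J_eq_sum`, a telescoped
Bellman equation). It remains to average over the states of `q` instead. The mean advantage is
bounded by `δₜ`, so this costs at most `δₜ` times the gap between the two state laws on test
functions bounded by `1`. That gap starts at zero and grows by at most `2√ε` per step
(`abs_integral_stateDist_sub_le`): each step adds one change of action law, paid for by a
Pinsker-type bound averaged over the states of `q`. -/

namespace InformationTheory

/-! ### Relative entropy and bounded test functions -/

lemma sq_sqrt_sub_one_le_klFun {x : ℝ} (hx : 0 ≤ x) : (√x - 1) ^ 2 ≤ klFun x := by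
  rcases hx.eq_or_lt with rfl | hx
  · simp [klFun_zero]
  have hy : 0 < √x := Real.sqrt_pos.2 hx
  have hxy : x = √x ^ 2 := (Real.sq_sqrt hx.le).symm
  have hlog : Real.log x = 2 * Real.log (√x) := by rw [Real.log_sqrt hx.le]; ring
  have h1 : √x - 1 ≤ √x * Real.log (√x) := by
    calc √x - 1 = √x * (1 - (√x)⁻¹) := by field_simp
      _ ≤ _ := mul_le_mul_of_nonneg_left (Real.one_sub_inv_le_log_of_pos hy) hy.le
  rw [klFun_apply, hlog]
  nlinarith [mul_le_mul_of_nonneg_left h1 hy.le]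

/-- Factor `x - 1 = (√x - 1)(√x + 1)` and apply weighted AM-GM. Keeping `c` free makes the bound
linear in `klFun x`, so it can later be averaged over states without Jensen. -/
lemma abs_sub_one_le_klFun {x c : ℝ} (hx : 0 ≤ x) (hc : 0 < c) :
    |x - 1| ≤ klFun x / (2 * c) + c * (x + 1) := by
  have hxy : √x ^ 2 = x := Real.sq_sqrt hx
  have h1 : |x - 1| = |√x - 1| * (√x + 1) := by
    rw [← abs_of_nonneg (by positivity : 0 ≤ √x + 1), ← abs_mul]
    congr 1
    nlinarith
  have h2 := sq_sqrt_sub_one_le_klFun hx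
  rw [← sq_abs] at h2
  have h3 : |√x - 1| * (√x + 1) ≤ |√x - 1| ^ 2 / (2 * c) + c * (√x + 1) ^ 2 / 2 := by
    rw [← sub_nonneg]
    have : |√x - 1| ^ 2 / (2 * c) + c * (√x + 1) ^ 2 / 2 - |√x - 1| * (√x + 1)
        = (|√x - 1| - c * (√x + 1)) ^ 2 / (2 * c) := by field_simp; ring
    rw [this]; positivity
  have h4 : |√x - 1| ^ 2 / (2 * c) ≤ klFun x / (2 * c) := by gcongr
  have h5 : (√x + 1) ^ 2 / 2 ≤ x + 1 := by nlinarith [sq_nonneg (√x - 1)]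
  have h6 : c * (√x + 1) ^ 2 / 2 ≤ c * (x + 1) := by
    rw [mul_div_assoc]; gcongr
  linarith

/-- A Pinsker-type inequality in the form obtained from the Hellinger distance. -/
theorem abs_integral_sub_integral_le_klDiv {α : Type*} [MeasurableSpace α] {μ ν : Measure α}
    [IsProbabilityMeasure μ] [IsProbabilityMeasure ν] (hμν : klDiv μ ν ≠ ∞) {c : ℝ} (hc : 0 < c)
    {h : α → ℝ} (hm : Measurable h) (hb : ∀ x, |h x| ≤ 1) :
    |∫ x, h x ∂μ - ∫ x, h x ∂ν| ≤ (klDiv μ ν).toReal / (2 * c) + 2 * c := by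
  obtain ⟨hac, hint⟩ := klDiv_ne_top_iff.1 hμν
  have hkl := (integrable_klFun_rnDeriv_iff hac).2 hint
  have hr : Integrable (fun x => (μ.rnDeriv ν x).toReal) ν := Measure.integrable_toReal_rnDeriv
  have hr1 : ∫ x, (μ.rnDeriv ν x).toReal ∂ν = 1 := by
    simp [Measure.integral_toReal_rnDeriv hac]
  have hhν : Integrable h ν := .of_bound hm.aestronglyMeasurable 1 (.of_forall hb)
  have hhr : Integrable (fun x => (μ.rnDeriv ν x).toReal * h x) ν :=
    hr.mul_bdd (c := 1) hm.aestronglyMeasurable (.of_forall hb)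
  have hr2 : Integrable (fun x => c * ((μ.rnDeriv ν x).toReal + 1)) ν :=
    (hr.add (integrable_const 1)).const_mul c
  have hg : Integrable (fun x => klFun (μ.rnDeriv ν x).toReal / (2 * c)
      + c * ((μ.rnDeriv ν x).toReal + 1)) ν :=
    (hkl.div_const _).add hr2
  calc |∫ x, h x ∂μ - ∫ x, h x ∂ν|
      = |∫ x, ((μ.rnDeriv ν x).toReal * h x - h x) ∂ν| := by
        rw [integral_sub hhr hhν]
        congr 2
        exact (integral_rnDeriv_smul hac).symm
    _ ≤ ∫ x, |(μ.rnDeriv ν x).toReal * h x - h x| ∂ν := abs_integral_le_integral_abs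
    _ ≤ ∫ x, (klFun (μ.rnDeriv ν x).toReal / (2 * c) + c * ((μ.rnDeriv ν x).toReal + 1)) ∂ν := by
        refine integral_mono (hhr.sub hhν).abs hg fun x => ?_
        refine le_trans ?_ (abs_sub_one_le_klFun ENNReal.toReal_nonneg hc)
        dsimp only
        rw [← sub_one_mul, abs_mul]
        exact mul_le_of_le_one_right (abs_nonneg _) (hb x)
    _ = (klDiv μ ν).toReal / (2 * c) + 2 * c := by
        rw [integral_add (hkl.div_const _) hr2,
          integral_div, integral_const_mul, integral_add hr (integrable_const 1), hr1,
          toReal_klDiv_eq_integral_klFun hac]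
        simp; ring

/-- If the average of the relative entropies of two Markov kernels is at most `ε`, then the averages
of the integrals of a test function with values in `[-1, 1]` differ by at most `2 √ε`. -/
theorem abs_integral_integral_sub_le_of_lintegral_klDiv_le {α β : Type*} [MeasurableSpace α]
    [MeasurableSpace β] {ν : Measure α} [IsProbabilityMeasure ν] {κ η : Kernel α β}
    [IsMarkovKernel κ] [IsMarkovKernel η] {ε : ℝ} (hε : 0 < ε)
    (hkl : ∫⁻ s, klDiv (κ s) (η s) ∂ν ≤ ENNReal.ofReal ε)
    {h : α → β → ℝ} (hm : ∀ s, Measurable (h s)) (hb : ∀ s a, |h s a| ≤ 1) :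
    |∫ s, (∫ a, h s a ∂(κ s) - ∫ a, h s a ∂(η s)) ∂ν| ≤ 2 * √ε := by
  -- This `c` balances the two terms: `ε / (2c) = 2c = √ε`.
  set c := √ε / 2 with hc_def
  have hsε : 0 < √ε := Real.sqrt_pos.2 hε
  have hc : 0 < c := by positivity
  -- In `ℝ≥0∞` the bound also covers states of infinite divergence, and averaging it needs no
  -- measurability of the divergence in `s`.
  have hpt : ∀ s, ‖∫ a, h s a ∂(κ s) - ∫ a, h s a ∂(η s)‖ₑ
      ≤ ENNReal.ofReal (1 / (2 * c)) * klDiv (κ s) (η s) + ENNReal.ofReal (2 * c) := fun s => by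
    by_cases htop : klDiv (κ s) (η s) = ∞
    · rw [htop, ENNReal.mul_top (by simpa using hc)]
      simp
    · have := abs_integral_sub_integral_le_klDiv htop hc (hm s) (hb s)
      rw [← ofReal_norm, Real.norm_eq_abs]
      refine (ENNReal.ofReal_le_ofReal this).trans ?_
      rw [ENNReal.ofReal_add (by positivity) (by positivity), div_eq_inv_mul,
        ENNReal.ofReal_mul (by positivity), ENNReal.ofReal_toReal htop, one_div]
  have hle : ‖∫ s, (∫ a, h s a ∂(κ s) - ∫ a, h s a ∂(η s)) ∂ν‖ₑ ≤ ENNReal.ofReal (2 * √ε) := by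
    calc _ ≤ ∫⁻ s, ‖∫ a, h s a ∂(κ s) - ∫ a, h s a ∂(η s)‖ₑ ∂ν := enorm_integral_le_lintegral_enorm _
      _ ≤ ∫⁻ s, (ENNReal.ofReal (1 / (2 * c)) * klDiv (κ s) (η s) + ENNReal.ofReal (2 * c)) ∂ν :=
        lintegral_mono hpt
      _ ≤ ENNReal.ofReal (1 / (2 * c)) * ENNReal.ofReal ε + ENNReal.ofReal (2 * c) := by
        rw [lintegral_add_right _ measurable_const, lintegral_const_mul' _ _ ENNReal.ofReal_ne_top]
        simp only [lintegral_const, measure_univ, mul_one]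
        gcongr
      _ = ENNReal.ofReal (2 * √ε) := by
        rw [← ENNReal.ofReal_mul (by positivity), ← ENNReal.ofReal_add (by positivity) (by positivity)]
        congr 1
        rw [hc_def]
        field_simp
        rw [Real.sq_sqrt hε.le]; ring
  rw [← ofReal_norm, Real.norm_eq_abs] at hle
  exact (ENNReal.ofReal_le_ofReal_iff (by positivity)).1 hle

end InformationTheory

/-! ### Integrals against composed kernels -/

namespace MeasureTheory

lemma Integrable.integral_measure_comp {α β : Type*} [MeasurableSpace α] [MeasurableSpace β]
    {μ : Measure α} {κ : Kernel α β} {f : β → ℝ} (hf : Integrable f (κ ∘ₘ μ)) :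
    Integrable (fun x => ∫ y, f y ∂(κ x)) μ := by
  rw [Measure.comp_eq_comp_const_apply] at hf
  simpa using hf.integral_comp

lemma Measure.integral_comp_eq {α β : Type*} [MeasurableSpace α] [MeasurableSpace β]
    {μ : Measure α} {κ : Kernel α β} {f : β → ℝ} (hf : Integrable f (κ ∘ₘ μ)) :
    ∫ y, f y ∂(κ ∘ₘ μ) = ∫ x, ∫ y, f y ∂(κ x) ∂μ := by
  rw [Measure.comp_eq_comp_const_apply] at hf ⊢
  simpa using Kernel.integral_comp hf

lemma Measure.integrable_compProd_of_integrable {α β : Type*} [MeasurableSpace α]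
    [MeasurableSpace β] {μ : Measure α} [SFinite μ] {κ : Kernel α β} [IsSFiniteKernel κ]
    {f : α × β → ℝ} (hf : Integrable f (μ ⊗ₘ κ)) :
    Integrable (fun x => ∫ y, f (x, y) ∂(κ x)) μ := by
  simpa using Integrable.integral_compProd hf

lemma integrable_of_abs_le {α : Type*} [MeasurableSpace α] {μ : Measure α} [IsFiniteMeasure μ]
    {f : α → ℝ} (hf : Measurable f) {C : ℝ} (hC : ∀ x, |f x| ≤ C) : Integrable f μ :=
  .of_bound hf.aestronglyMeasurable C (.of_forall hC)

lemma abs_integral_le_of_abs_le {α : Type*} [MeasurableSpace α] {μ : Measure α}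
    [IsProbabilityMeasure μ] {f : α → ℝ} {C : ℝ} (hC : ∀ x, |f x| ≤ C) : |∫ x, f x ∂μ| ≤ C := by
  simpa using norm_integral_le_of_norm_le_const (f := f) (μ := μ) (C := C) (.of_forall hC)

end MeasureTheory

/-! ### Marginals of the path law and the Bellman equation -/

noncomputable section

namespace MDP

variable {S A : Type*} [MeasurableSpace S] [MeasurableSpace A]

/-- The kernel that sends `(sₜ, aₜ)` to the law of `(sₜ₊ᵢ, aₜ₊ᵢ)` under the policy `π`. -/
def iterStep (M : MDP S A) (π : Policy S A) (t : ℕ) : ℕ → Kernel (S × A) (S × A)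
  | 0 => Kernel.id
  | i + 1 => M.step π (t + i) ∘ₖ iterStep M π t i

instance (M : MDP S A) (π : Policy S A) (t i : ℕ) : IsMarkovKernel (M.iterStep π t i) := by
  induction i with
  | zero => unfold iterStep; infer_instance
  | succ i ih => unfold iterStep; infer_instance

/-- The definition splits off the last step; the Bellman equation conditions on the first. -/
lemma iterStep_succ' (M : MDP S A) (π : Policy S A) (t i : ℕ) :
    M.iterStep π t (i + 1) = M.iterStep π (t + 1) i ∘ₖ M.step π t := by
  induction i with
  | zero => simp [iterStep]
  | succ i ih =>
    rw [iterStep, ih, ← Kernel.comp_assoc]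
    simp only [iterStep]
    rw [show t + (i + 1) = t + 1 + i by ring]

/-- Each reward sees a single coordinate of the path, so one-time marginals replace the path law
from here on. -/
lemma pathLaw_map_eval (M : MDP S A) (π : Policy S A) (t i : ℕ) (μ : Measure (S × A))
    [IsProbabilityMeasure μ] :
    (M.pathLaw π t μ).map (fun ω => ω i) = M.iterStep π t i ∘ₘ μ := by
  induction i with
  | zero =>
    have h0 : (fun ω : ℕ → S × A => ω 0)
        = (fun h : (i : Finset.Iic 0) → S × A => h ⟨0, Finset.mem_Iic.2 le_rfl⟩) ∘
          Preorder.frestrictLe (π := fun _ : ℕ => S × A) 0 := rfl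
    have he : Measurable
        (fun h : (i : Finset.Iic 0) → S × A => h ⟨0, Finset.mem_Iic.2 le_rfl⟩) :=
      measurable_pi_apply _
    rw [iterStep, Measure.id_comp, h0, ← Measure.map_map he (Preorder.measurable_frestrictLe _),
      pathLaw, Kernel.trajMeasure, Measure.map_comp _ _ (Preorder.measurable_frestrictLe _),
      Kernel.traj_map_frestrictLe, Kernel.partialTraj_self, Measure.id_comp,
      Measure.map_map he (by fun_prop)]
    exact Measure.map_id
  | succ i ih =>
    -- The joint law of the history up to `i` and the next coordinate; its second marginal is the
    -- law sought, and the kernel reads only the last entry of the history.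
    have h1 := Kernel.map_frestrictLe_trajMeasure_compProd_eq_map_trajMeasure
      (X := fun _ => S × A) (μ₀ := μ) (κ := fun n =>
        (M.step π (t + n)).comap (fun h => h ⟨n, Finset.mem_Iic.2 le_rfl⟩)
          (measurable_pi_apply _)) (a := i)
    have h2 := congrArg Measure.snd h1
    rw [Measure.snd_compProd, Measure.snd_map_prodMk (by fun_prop)] at h2
    rw [iterStep, ← Measure.comp_assoc, ← ih, pathLaw, ← h2,
      ← Kernel.comp_deterministic_eq_comap, ← Measure.comp_assoc,
      Measure.deterministic_comp_eq_map, Measure.map_map (by fun_prop) (by fun_prop)]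
    rfl

lemma integrable_pathLaw_iff (M : MDP S A) (π : Policy S A) (t i : ℕ) (μ : Measure (S × A))
    [IsProbabilityMeasure μ] {r : S × A → ℝ} (hr : Measurable r) :
    Integrable (fun ω => r (ω i)) (M.pathLaw π t μ) ↔
      Integrable r (M.iterStep π t i ∘ₘ μ) := by
  rw [← pathLaw_map_eval, integrable_map_measure hr.aestronglyMeasurable
    (measurable_pi_apply i).aemeasurable]
  rfl

lemma integral_pathLaw (M : MDP S A) (π : Policy S A) (t i : ℕ) (μ : Measure (S × A))
    [IsProbabilityMeasure μ] {r : S × A → ℝ} (hr : Measurable r) :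
    ∫ ω, r (ω i) ∂(M.pathLaw π t μ) = ∫ x, r x ∂(M.iterStep π t i ∘ₘ μ) := by
  rw [← pathLaw_map_eval, integral_map (measurable_pi_apply i).aemeasurable
    hr.aestronglyMeasurable]

lemma HasQ.integrable {M : MDP S A} {T : ℕ} {π : Policy S A} (h : M.HasQ T π) {t i : ℕ}
    (hti : t + i < T) (x : S × A) : Integrable (M.reward (t + i)) (M.iterStep π t i x) := by
  have := (M.integrable_pathLaw_iff π t i (Measure.dirac x) (M.reward_meas (t + i))).1
    (h t (by omega) i (by omega) x)
  rwa [Measure.dirac_bind (Kernel.measurable _)] at this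

lemma HasQ.Q_eq_sum {M : MDP S A} {T : ℕ} {π : Policy S A} (h : M.HasQ T π) (t : ℕ)
    (x : S × A) :
    M.Q T π t x = ∑ i ∈ Finset.range (T - t), ∫ y, M.reward (t + i) y ∂(M.iterStep π t i x) := by
  rw [Q, integral_finsetSum]
  · refine Finset.sum_congr rfl fun i _ => ?_
    rw [integral_pathLaw _ _ _ _ _ (M.reward_meas _), Measure.dirac_bind (Kernel.measurable _)]
  · intro i hi
    have := Finset.mem_range.1 hi
    exact h t (by omega) i this x

lemma Q_eq_zero (M : MDP S A) (T : ℕ) (π : Policy S A) (x : S × A) : M.Q T π T x = 0 := by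
  simp [Q]

lemma V_eq_zero (M : MDP S A) (T : ℕ) (π : Policy S A) (s : S) : M.V T π T s = 0 := by
  simp [V, Q_eq_zero]

lemma HasQ.measurable_Q {M : MDP S A} {T : ℕ} {π : Policy S A} (h : M.HasQ T π) (t : ℕ) :
    Measurable (M.Q T π t) := by
  rw [funext (h.Q_eq_sum t)]
  exact Finset.measurable_fun_sum _ fun i _ =>
    ((M.reward_meas _).stronglyMeasurable.integral_kernel).measurable

lemma HasQ.measurable_V {M : MDP S A} {T : ℕ} {π : Policy S A} (h : M.HasQ T π) (t : ℕ) :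
    Measurable (M.V T π t) :=
  ((h.measurable_Q t).stronglyMeasurable.integral_kernel_prod_right').measurable

lemma HasQ.measurable_meanAdv {M : MDP S A} {T : ℕ} {p q : Policy S A} (h : M.HasQ T q) (t : ℕ) :
    Measurable (M.meanAdv T p q t) := by
  have : Measurable fun x : S × A => M.Q T q t x - M.V T q t x.1 :=
    (h.measurable_Q t).sub ((h.measurable_V t).comp measurable_fst)
  exact (this.stronglyMeasurable.integral_kernel_prod_right' (κ := p.act t)).measurable

lemma meanAdv_eq {M : MDP S A} {T : ℕ} {p q : Policy S A} (h : M.HasMeanQ T p q) {t : ℕ}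
    (ht : t < T) (s : S) :
    M.meanAdv T p q t s = ∫ a, M.Q T q t (s, a) ∂(p.act t s) - M.V T q t s := by
  simp only [meanAdv, adv]
  rw [integral_sub (h t ht s) (integrable_const _)]
  simp

lemma HasQ.integrable_Q_step {M : MDP S A} {T : ℕ} {π : Policy S A} (h : M.HasQ T π) (t : ℕ)
    (x : S × A) : Integrable (M.Q T π (t + 1)) (M.step π t x) := by
  rw [funext (h.Q_eq_sum (t + 1))]
  refine integrable_finsetSum _ fun i hi => ?_
  have hi' := Finset.mem_range.1 hi
  have := h.integrable (t := t) (i := i + 1) (by omega) x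
  rw [iterStep_succ', show t + (i + 1) = t + 1 + i by ring] at this
  exact this.integral_comp

lemma HasQ.bellman {M : MDP S A} {T : ℕ} {π : Policy S A} (h : M.HasQ T π) {t : ℕ}
    (ht : t < T) (x : S × A) :
    M.Q T π t x = M.reward t x + ∫ s, M.V T π (t + 1) s ∂(M.trans x) := by
  have hV : ∫ s, M.V T π (t + 1) s ∂(M.trans x) = ∫ y, M.Q T π (t + 1) y ∂(M.step π t x) := by
    rw [step, integral_compProd (by simpa [step] using h.integrable_Q_step t x)]
    rfl
  rw [hV, h.Q_eq_sum t, show T - t = (T - (t + 1)) + 1 by omega, Finset.sum_range_succ', add_comm]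
  congr 1
  · simp only [iterStep, Nat.add_zero, Kernel.id_apply]
    exact integral_dirac' _ _ (M.reward_meas t).stronglyMeasurable
  · rw [funext (h.Q_eq_sum (t + 1))]
    have hint : ∀ i ∈ Finset.range (T - (t + 1)), Integrable (M.reward (t + 1 + i))
        ((M.iterStep π (t + 1) i ∘ₖ M.step π t) x) := fun i hi => by
      have hi' := Finset.mem_range.1 hi
      have := h.integrable (t := t) (i := i + 1) (by omega) x
      rwa [iterStep_succ', show t + (i + 1) = t + 1 + i by ring] at this
    rw [integral_finsetSum _ fun i hi => (hint i hi).integral_comp]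
    refine Finset.sum_congr rfl fun i hi => ?_
    rw [iterStep_succ', show t + (i + 1) = t + 1 + i by ring, Kernel.integral_comp (hint i hi)]

/-! ### State-action laws and the return -/

/-- The law of the state-action pair at time-step `t` under the policy `π`. -/
def pairDist (M : MDP S A) (π : Policy S A) (t : ℕ) : Measure (S × A) :=
  M.iterStep π 0 t ∘ₘ (M.init ⊗ₘ π.act 0)

instance (M : MDP S A) (π : Policy S A) (t : ℕ) : IsProbabilityMeasure (M.pairDist π t) := by
  unfold pairDist; infer_instance

lemma trajLaw_map_eval (M : MDP S A) (π : Policy S A) (t : ℕ) :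
    (M.trajLaw π).map (fun ω => ω t) = M.pairDist π t :=
  M.pathLaw_map_eval π 0 t _

lemma stateDist_eq_fst (M : MDP S A) (π : Policy S A) (t : ℕ) :
    M.stateDist π t = (M.pairDist π t).fst := by
  rw [← trajLaw_map_eval, Measure.fst, Measure.map_map measurable_fst (measurable_pi_apply t)]
  rfl

instance (M : MDP S A) (π : Policy S A) (t : ℕ) : IsProbabilityMeasure (M.stateDist π t) := by
  rw [stateDist_eq_fst]; infer_instance

lemma stateDist_zero (M : MDP S A) (π : Policy S A) : M.stateDist π 0 = M.init := by
  rw [stateDist_eq_fst, pairDist, iterStep, Measure.id_comp, Measure.fst_compProd]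

lemma pairDist_succ (M : MDP S A) (π : Policy S A) (t : ℕ) :
    M.pairDist π (t + 1) = (M.trans ∘ₘ M.pairDist π t) ⊗ₘ π.act (t + 1) := by
  have : M.pairDist π (t + 1) = M.step π t ∘ₘ M.pairDist π t := by
    rw [pairDist, pairDist, iterStep, ← Measure.comp_assoc, zero_add]
  rw [this, step, Kernel.compProd_prodMkLeft_eq_comp, ← Measure.comp_assoc,
    Measure.compProd_eq_comp_prod]

lemma stateDist_succ (M : MDP S A) (π : Policy S A) (t : ℕ) :
    M.stateDist π (t + 1) = M.trans ∘ₘ M.pairDist π t := by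
  rw [stateDist_eq_fst, pairDist_succ, Measure.fst_compProd]

lemma pairDist_eq_compProd (M : MDP S A) (π : Policy S A) (t : ℕ) :
    M.pairDist π t = M.stateDist π t ⊗ₘ π.act t := by
  cases t with
  | zero => rw [stateDist_zero, pairDist, iterStep, Measure.id_comp]
  | succ t => rw [pairDist_succ, stateDist_succ]

lemma HasReturn.integrable {M : MDP S A} {T : ℕ} {π : Policy S A} (h : M.HasReturn T π) {t : ℕ}
    (ht : t < T) : Integrable (M.reward t) (M.pairDist π t) :=
  (M.integrable_pathLaw_iff π 0 t _ (M.reward_meas t)).1 (h t ht)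

lemma HasReturn.J_eq_sum {M : MDP S A} {T : ℕ} {π : Policy S A} (h : M.HasReturn T π) :
    M.J T π = ∑ t ∈ Finset.range T, ∫ x, M.reward t x ∂(M.pairDist π t) := by
  rw [J, integral_finsetSum _ fun t ht => h t (Finset.mem_range.1 ht)]
  exact Finset.sum_congr rfl fun t _ => M.integral_pathLaw π 0 t _ (M.reward_meas t)

lemma HasReturn.J_eq_integral_V {M : MDP S A} {T : ℕ} {π : Policy S A} (h : M.HasReturn T π)
    (hQ : M.HasQ T π) : M.J T π = ∫ s, M.V T π 0 s ∂M.init := by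
  have hint : ∀ t ∈ Finset.range T, Integrable
      (fun x => ∫ y, M.reward t y ∂(M.iterStep π 0 t x)) (M.init ⊗ₘ π.act 0) := fun t ht =>
    Integrable.integral_measure_comp (h.integrable (Finset.mem_range.1 ht))
  have hQ0 : M.Q T π 0
      = fun x => ∑ t ∈ Finset.range T, ∫ y, M.reward t y ∂(M.iterStep π 0 t x) := by
    funext x
    simpa using hQ.Q_eq_sum 0 x
  have hQint : Integrable (M.Q T π 0) (M.init ⊗ₘ π.act 0) := by
    rw [hQ0]
    exact integrable_finsetSum _ hint
  calc M.J T π = ∑ t ∈ Finset.range T,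
        ∫ x, ∫ y, M.reward t y ∂(M.iterStep π 0 t x) ∂(M.init ⊗ₘ π.act 0) := by
        rw [h.J_eq_sum]
        exact Finset.sum_congr rfl fun t ht =>
          Measure.integral_comp_eq (h.integrable (Finset.mem_range.1 ht))
    _ = ∫ x, M.Q T π 0 x ∂(M.init ⊗ₘ π.act 0) := by
        rw [hQ0, integral_finsetSum _ hint]
    _ = ∫ s, M.V T π 0 s ∂M.init := Measure.integral_compProd hQint

lemma abs_meanAdv_le {M : MDP S A} {T : ℕ} {p q : Policy S A} {t : ℕ}
    (hb : BddAbove (Set.range fun s => |M.meanAdv T p q t s|)) (s : S) :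
    |M.meanAdv T p q t s| ≤ M.maxMeanAdv T p q t :=
  le_ciSup hb s

lemma integrable_meanAdv {M : MDP S A} {T : ℕ} {p q : Policy S A} {t : ℕ} (hQ : M.HasQ T q)
    (hb : BddAbove (Set.range fun s => |M.meanAdv T p q t s|)) (μ : Measure S)
    [IsFiniteMeasure μ] : Integrable (M.meanAdv T p q t) μ :=
  integrable_of_abs_le (hQ.measurable_meanAdv t) (abs_meanAdv_le hb)

/-! ### Performance difference lemma -/

section PerformanceDifference

variable {M : MDP S A} {T : ℕ} {p q : Policy S A}

lemma integrable_Q_of_integrable_V (hp : M.HasReturn T p) (hQ : M.HasQ T q) {t : ℕ} (ht : t < T)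
    (hV : Integrable (M.V T q (t + 1)) (M.stateDist p (t + 1))) :
    Integrable (M.Q T q t) (M.pairDist p t) := by
  rw [funext (hQ.bellman ht)]
  rw [stateDist_succ] at hV
  exact (hp.integrable ht).add hV.integral_measure_comp

lemma integrable_V_of_integrable_Q (hQ : M.HasQ T q) (hpq : M.HasMeanQ T p q) {t : ℕ} (ht : t < T)
    (hb : BddAbove (Set.range fun s => |M.meanAdv T p q t s|))
    (hQi : Integrable (M.Q T q t) (M.pairDist p t)) :
    Integrable (M.V T q t) (M.stateDist p t) := by
  rw [pairDist_eq_compProd] at hQi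
  have h := (Measure.integrable_compProd_of_integrable hQi).sub
    (integrable_meanAdv hQ hb (M.stateDist p t))
  refine h.congr (.of_forall fun s => ?_)
  simp [meanAdv_eq hpq ht]

/-- Values of `q` along states of `p`, by backward induction from `V_T = 0`: the Bellman equation
passes from `V` at `t + 1` to `Q` at `t`, and `V` differs from the `p`-average of `Q` by the bounded
mean advantage. -/
lemma integrable_V (hp : M.HasReturn T p) (hQ : M.HasQ T q) (hpq : M.HasMeanQ T p q)
    (hb : ∀ t < T, BddAbove (Set.range fun s => |M.meanAdv T p q t s|)) {t : ℕ} (ht : t ≤ T) :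
    Integrable (M.V T q t) (M.stateDist p t) := by
  induction ht using Nat.decreasingInduction with
  | self => simp [funext (M.V_eq_zero T q)]
  | of_succ t ht ih =>
    exact integrable_V_of_integrable_Q hQ hpq ht (hb t ht) (integrable_Q_of_integrable_V hp hQ ht ih)

lemma integral_meanAdv (hp : M.HasReturn T p) (hQ : M.HasQ T q) (hpq : M.HasMeanQ T p q)
    (hb : ∀ t < T, BddAbove (Set.range fun s => |M.meanAdv T p q t s|)) {t : ℕ} (ht : t < T) :
    ∫ s, M.meanAdv T p q t s ∂(M.stateDist p t) = ∫ x, M.reward t x ∂(M.pairDist p t)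
      + (∫ s, M.V T q (t + 1) s ∂(M.stateDist p (t + 1)) - ∫ s, M.V T q t s ∂(M.stateDist p t)) := by
  have hV1 := integrable_V hp hQ hpq hb (Nat.succ_le_of_lt ht)
  have hQi := integrable_Q_of_integrable_V hp hQ ht hV1
  have hQi' := hQi
  rw [pairDist_eq_compProd] at hQi'
  rw [Nat.succ_eq_add_one, stateDist_succ] at hV1
  have h1 : ∫ x, M.Q T q t x ∂(M.pairDist p t) = ∫ x, M.reward t x ∂(M.pairDist p t)
      + ∫ s, M.V T q (t + 1) s ∂(M.stateDist p (t + 1)) := by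
    rw [funext (hQ.bellman ht), integral_add (hp.integrable ht) hV1.integral_measure_comp,
      stateDist_succ, Measure.integral_comp_eq hV1]
  have h2 : ∫ x, M.Q T q t x ∂(M.pairDist p t)
      = ∫ s, ∫ a, M.Q T q t (s, a) ∂(p.act t s) ∂(M.stateDist p t) := by
    rw [pairDist_eq_compProd, Measure.integral_compProd hQi']
  rw [funext (meanAdv_eq hpq ht), integral_sub (Measure.integrable_compProd_of_integrable hQi')
    (integrable_V hp hQ hpq hb ht.le), ← h2, h1]
  ring

/-- The performance difference lemma. -/
theorem J_sub_J_eq_sum (hp : M.HasReturn T p) (hq : M.HasReturn T q) (hQ : M.HasQ T q)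
    (hpq : M.HasMeanQ T p q)
    (hb : ∀ t < T, BddAbove (Set.range fun s => |M.meanAdv T p q t s|)) :
    M.J T p - M.J T q
      = ∑ t ∈ Finset.range T, ∫ s, M.meanAdv T p q t s ∂(M.stateDist p t) := by
  -- The value terms telescope: the one at `T` vanishes and the one at `0` is `J q`, since both
  -- policies share `M.init`.
  rw [Finset.sum_congr rfl fun t ht =>
      integral_meanAdv hp hQ hpq hb (Finset.mem_range.1 ht), Finset.sum_add_distrib,
    Finset.sum_range_sub (fun t => ∫ s, M.V T q t s ∂(M.stateDist p t)), ← hp.J_eq_sum,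
    hq.J_eq_integral_V hQ, stateDist_zero]
  simp only [V_eq_zero, integral_zero]
  ring

end PerformanceDifference

/-! ### Drift of the state distributions -/

/-- The state distributions of two policies drift apart at most linearly in time, as long as the
relative entropies of the action laws, averaged over the states visited by the second policy, are
at most `ε`. -/
theorem abs_integral_stateDist_sub_le (M : MDP S A) (p q : Policy S A) {ε : ℝ} (hε : 0 < ε) (t : ℕ)
    (hkl : ∀ i < t, ∫⁻ s, klDiv (p.act i s) (q.act i s) ∂(M.stateDist q i) ≤ ENNReal.ofReal ε)
    {h : S → ℝ} (hm : Measurable h) (hb : ∀ s, |h s| ≤ 1) :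
    |∫ s, h s ∂(M.stateDist p t) - ∫ s, h s ∂(M.stateDist q t)| ≤ t * (2 * √ε) := by
  induction t generalizing h with
  | zero => simp [stateDist_zero]
  | succ t ih =>
    set g : S × A → ℝ := fun x => ∫ s, h s ∂(M.trans x)
    have hg : Measurable g := hm.stronglyMeasurable.integral_kernel.measurable
    have hg1 : ∀ x, |g x| ≤ 1 := fun x => abs_integral_le_of_abs_le hb
    have hgπ : ∀ π : Policy S A, Measurable fun s => ∫ a, g (s, a) ∂(π.act t s) := fun π =>
      (hg.stronglyMeasurable.integral_kernel_prod_right' (κ := π.act t)).measurable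
    have hgπ1 : ∀ (π : Policy S A) s, |∫ a, g (s, a) ∂(π.act t s)| ≤ 1 := fun π s =>
      abs_integral_le_of_abs_le fun a => hg1 (s, a)
    have hstep : ∀ π : Policy S A, ∫ s, h s ∂(M.stateDist π (t + 1))
        = ∫ s, ∫ a, g (s, a) ∂(π.act t s) ∂(M.stateDist π t) := fun π => by
      rw [stateDist_succ, Measure.integral_comp_eq (integrable_of_abs_le hm hb),
        pairDist_eq_compProd, Measure.integral_compProd (integrable_of_abs_le hg hg1)]
    -- Triangle inequality through states of `q` with actions of `p`: `h1` changes the state law,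
    -- `h2` the action law.
    have h1 := ih (fun i hi => hkl i (by omega)) (hgπ p) (hgπ1 p)
    have h2 := abs_integral_integral_sub_le_of_lintegral_klDiv_le hε (hkl t (by omega))
      (h := fun s a => g (s, a)) (fun s => hg.comp measurable_prodMk_left) (fun s a => hg1 (s, a))
    rw [integral_sub (integrable_of_abs_le (hgπ p) (hgπ1 p))
      (integrable_of_abs_le (hgπ q) (hgπ1 q))] at h2
    rw [hstep p, hstep q]
    push_cast
    rw [abs_le] at h1 h2 ⊢
    constructor <;> linarith [h1.1, h1.2, h2.1, h2.2]

lemma abs_integral_stateDist_sub_le_mul (M : MDP S A) (p q : Policy S A) {ε : ℝ} (hε : 0 < ε)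
    (t : ℕ)
    (hkl : ∀ i < t, ∫⁻ s, klDiv (p.act i s) (q.act i s) ∂(M.stateDist q i) ≤ ENNReal.ofReal ε)
    {h : S → ℝ} (hm : Measurable h) {C : ℝ} (hC : 0 ≤ C) (hb : ∀ s, |h s| ≤ C) :
    |∫ s, h s ∂(M.stateDist p t) - ∫ s, h s ∂(M.stateDist q t)| ≤ C * (t * (2 * √ε)) := by
  rcases hC.eq_or_lt with rfl | hC
  · have : h = 0 := funext fun s => abs_nonpos_iff.1 (hb s)
    simp [this]
  · have := M.abs_integral_stateDist_sub_le p q hε t hkl (hm.div_const C) (fun s => by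
      rw [abs_div, abs_of_pos hC]
      exact div_le_one_of_le₀ (hb s) hC.le)
    rwa [integral_div, integral_div, ← sub_div, abs_div, abs_of_pos hC, div_le_iff₀' hC] at this

end MDP

end

/-! ### The bound -/

theorem mainTheorem1 (ds : ℕ) :
    ∃ f : ℕ → ℝ → ℝ,
      (∀ t, f t =O[𝓝[>] (0 : ℝ)] fun ε => Real.sqrt ε) ∧
      ∀ (da T : ℕ)
        (M : MDP (EuclideanSpace ℝ (Fin ds)) (EuclideanSpace ℝ (Fin da)))
        (p q : Policy (EuclideanSpace ℝ (Fin ds)) (EuclideanSpace ℝ (Fin da)))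
        (ε : ℝ), 0 < ε →
        M.HasReturn T p → M.HasReturn T q → M.HasQ T q → M.HasMeanQ T q q → M.HasMeanQ T p q →
        (∀ t < T, BddAbove (Set.range fun s => |M.meanAdv T p q t s|)) →
        (∀ t < T, IsGaussian (M.stateDist p t) ∧ IsGaussian (M.stateDist q t)) →
        (∀ t < T, IsLinearGaussian (p.act t) ∧ IsLinearGaussian (q.act t)) →
        (∀ t < T, ∫⁻ s, klDiv (p.act t s) (q.act t s) ∂(M.stateDist q t) ≤ ENNReal.ofReal ε) →
        M.J T p - M.J T q ≥
          ∑ t ∈ Finset.range T, ∫ s, ∫ a, M.adv T q t s a ∂(p.act t s) ∂(M.stateDist q t) -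
            ∑ t ∈ Finset.range T, M.maxMeanAdv T p q t * f t ε := by
  refine ⟨fun t ε => t * (2 * √ε), fun t => ?_, ?_⟩
  · exact ((Asymptotics.isBigO_refl _ _).const_mul_left 2).const_mul_left (t : ℝ)
  intro da T M p q ε hε hp hq hQ _ hpq hb _ _ hkl
  rw [MDP.J_sub_J_eq_sum hp hq hQ hpq hb, ge_iff_le, ← Finset.sum_sub_distrib]
  refine Finset.sum_le_sum fun t ht => ?_
  have ht' := Finset.mem_range.1 ht
  have h := M.abs_integral_stateDist_sub_le_mul p q hε t (fun i hi => hkl i (by omega))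
    -- Any state, here `0`, shows `δₜ ≥ 0`.
    (hQ.measurable_meanAdv t) ((abs_nonneg _).trans (MDP.abs_meanAdv_le (hb t ht') 0))
    (MDP.abs_meanAdv_le (hb t ht'))
  have h' := (abs_le.1 h).1
  change ∫ s, M.meanAdv T p q t s ∂(M.stateDist q t) - _ ≤ _
  linarith
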